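/- Consider the discrete nonlinear Schrödinger equation on a stripe lattice with transverse dispersion $\kappa=+1$, $$i\,\partial_t u_m+\epsilon\,(u_{m+1}+u_{m-1}-2u_m)+\kappa\,\partial_y^2u_m+|u_m|^2u_m=0,\qquad m\in\mathbb Z,\ y\in\mathbb R,\ \epsilon>0,$$ and a line soliton $u_m(y,t)=e^{it}\psi_m$ (frequency parameter $\mu=1$), where $\psi=\psi^{(\epsilon)}\in\ell^2(\mathbb Z)$ is real and satisfies $$-\psi_m+\epsilon(\psi_{m+1}+\psi_{m-1}-2\psi_m)+|\psi_m|^2\psi_m=0,\qquad m\in\mathbb Z .$$ The soliton is called fundamental if $\psi^{(\epsilon)}_m>0$ for all $m\in\mathbb Z$ and $\epsilon>0$ and if it is confined to the single site $m=0$ in the anti-continuum limit, i.e. $\psi^{(\epsilon)}\to(\delta_{m,0})_{m\in\mathbb Z}$ in $\ell^2(\mathbb Z)$ as $\epsilon\to0^+$. For $p\in\mathbb R$ let $$(L_+(p)U)_m=-\epsilon(U_{m+1}+U_{m-1}-2U_m)+(1+\kappa p^2)U_m-3\psi_m^2U_m,$$ $$(L_-(p)W)_m=-\epsilon(W_{m+1}+W_{m-1}-2W_m)+(1+\kappa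 p^2)W_m-\psi_m^2W_m,$$ and call $\lambda\in\mathbb C$ an eigenvalue at wavenumber $p$ if $L_+(p)U=-\lambda W$, $L_-(p)W=\lambda U$ for some nonzero $(U,W)\in\ell^2(\mathbb Z,\mathbb C)^2$. The line soliton is transversely unstable if for some real $p\neq0$ there is an eigenvalue with positive real part. **Theorem.** Let $\kappa=1$ and let $\psi^{(\epsilon)}$, $\epsilon>0$, be the fundamental soliton. For every $\epsilon>0$ there is $p_0(\epsilon)>0$ such that for every real $p$ with $0<|p|<p_0(\epsilon)$ there is a pair of real eigenvalues $\pm\lambda(\epsilon,p)$ with $\lambda(\epsilon,p)>0$, while for $|p|\ge p_0(\epsilon)$ there is no eigenvalue with positive real part. Hence the line soliton is transversely unstable for every $\epsilon>0$. Moreover, as $\epsilon\to0^+$, $$p_0(\epsilon)=\sqrt2+\mathcal O(\epsilon),\qquad \lambda(\epsilon,p)=|p|\sqrt{2-p^2}+\mathcal O(\epsilon),$$ where for each $q\in(0,\sqrt2)$ the second expansion holds uniformly in $0<|p|\le q$ (in particular for each fixed $p$ with $0<|p|<\sqrt2$), and $q<p_0(\epsilon)$ for all sufficiently small $\epsilon$.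 -/

import Mathlib

open Filter Topology Asymptotics

namespace StripeLattice

/-- Square-summable real sequences on the lattice `ℤ`. -/
abbrev RealSeq : Type := lp (fun _ : ℤ => ℝ) 2

/-- Square-summable complex sequences on the lattice `ℤ`. -/
abbrev ComplexSeq : Type := lp (fun _ : ℤ => ℂ) 2

/-- The stationary one-dimensional dNLS equation
`-μ² ψ_m + ε (ψ_{m+1} + ψ_{m-1} - 2 ψ_m) + |ψ_m|² ψ_m = 0` for a real sequence `ψ`.
It says that `u_m(y,t) = e^{iμ²t} ψ_m` solves
`i ∂_t u_m + ε (u_{m+1} + u_{m-1} - 2 u_m) + κ ∂_y² u_m + |u_m|² u_m = 0`. -/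
def IsStationary (μ ε : ℝ) (ψ : ℤ → ℝ) : Prop :=
  ∀ m : ℤ,
    -μ ^ 2 * ψ m + ε * (ψ (m + 1) + ψ (m - 1) - 2 * ψ m) + |ψ m| ^ 2 * ψ m = 0

/-- A family `ψ ε`, `ε > 0`, of fundamental discrete solitons: each profile is
square-summable, everywhere positive and stationary, and in the anti-continuum limit
`ε → 0` the profile is confined to the single site `m = 0`
(at `ε = 0` the one-site positive solution is `μ` at that site and `0` elsewhere). -/
structure IsFundamentalSoliton (μ : ℝ) (ψ : ℝ → RealSeq) : Prop where
  stationary : ∀ ε : ℝ, 0 < ε → IsStationary μ ε (ψ ε)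
  pos : ∀ ε : ℝ, 0 < ε → ∀ m : ℤ, 0 < ψ ε m
  singleSite : Tendsto ψ (𝓝[>] 0) (𝓝 (lp.single 2 (0 : ℤ) μ))

/-- The operator
`(L₊(p) U)_m = -ε (U_{m+1} + U_{m-1} - 2 U_m) + (μ² + κ p²) U_m - 3 ψ_m² U_m`. -/
def Lplus (κ μ ε p : ℝ) (ψ : ℤ → ℝ) (U : ℤ → ℂ) (m : ℤ) : ℂ :=
  -(ε : ℂ) * (U (m + 1) + U (m - 1) - 2 * U m)
    + ((μ : ℂ) ^ 2 + (κ : ℂ) * (p : ℂ) ^ 2) * U m - 3 * (ψ m : ℂ) ^ 2 * U m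

/-- The operator
`(L₋(p) W)_m = -ε (W_{m+1} + W_{m-1} - 2 W_m) + (μ² + κ p²) W_m - ψ_m² W_m`. -/
def Lminus (κ μ ε p : ℝ) (ψ : ℤ → ℝ) (W : ℤ → ℂ) (m : ℤ) : ℂ :=
  -(ε : ℂ) * (W (m + 1) + W (m - 1) - 2 * W m)
    + ((μ : ℂ) ^ 2 + (κ : ℂ) * (p : ℂ) ^ 2) * W m - (ψ m : ℂ) ^ 2 * W m

/-- `lam` is an eigenvalue of the linear-stability problem
`L₊(p) U = -lam W`, `L₋(p) W = lam U` at transverse wavenumber `p`: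
there is a nonzero eigenvector `(U, W)` in `ℓ²(ℤ) × ℓ²(ℤ)`. -/
def IsStabilityEigenvalue (κ μ ε p : ℝ) (ψ : ℤ → ℝ) (lam : ℂ) : Prop :=
  ∃ U W : ComplexSeq, (U ≠ 0 ∨ W ≠ 0) ∧
    (∀ m : ℤ, Lplus κ μ ε p ψ U m = -lam * W m) ∧
    (∀ m : ℤ, Lminus κ μ ε p ψ W m = lam * U m)

/-- The line soliton is transversely unstable: some normal mode
`e^{lam t + i p y} (U_m + i W_m)` of the linearized equation with nonzero real transverse
wavenumber `p` grows exponentially in time. -/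
def IsTransverselyUnstable (κ μ ε : ℝ) (ψ : ℤ → ℝ) : Prop :=
  ∃ p : ℝ, p ≠ 0 ∧ ∃ lam : ℂ, 0 < lam.re ∧ IsStabilityEigenvalue κ μ ε p ψ lam

end StripeLattice

/-! Since `L₋(0)` annihilates the positive sequence `ψ`, it is nonnegative, so `L₋(p) = L₋(0) + p² ≥
p²`. Put `-p₀²` for the infimum of the quadratic form of `L₊(0)` on unit vectors; it is negative
because `⟨L₊(0)ψ, ψ⟩ = -2 ∑ ψ_m⁴`.

If `0 < p² < p₀²`, then with `S = √L₋(p)` the operator `S L₊(p) S` has a negative form value. It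
differs from `L₋(p)² ≥ 0` by a compact operator, so it has a negative eigenvalue `-lam²`, and
applying `S` yields `L₋ L₊ U = -lam² U` (`exists_neg_eigenvalue_mul`, `exists_pos_eigenvalue`). If
`p² ≥ p₀²`, both forms are nonnegative, and pairing the two equations with `U` and `W` excludes `0 <
Re z` (`not_isStabilityEigenvalue_of_re_pos`).

For small `ε` the stationary equation upgrades convergence of `ψ` to `O(ε)` bounds, so `L₊(p)` and
`L₋(p)` are `O(ε)`-close to `1 + p²` minus 3 and 1 times the projection onto site 0. This gives `p₀²
= 2 + O(ε)`. For `lam`, the first equation is projected on site 0 and the second on `ψ`, where the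
identity `p² ⟨ψ, W⟩ = lam ⟨ψ, U⟩` is exact. The error in `lam² = p² (2 - p²)` then carries a factor
`p² + lam`, which makes the expansion of `lam` uniform as `p → 0`. -/

namespace StripeLattice
open scoped InnerProductSpace

/-! ### Spectral theory of products of self-adjoint operators -/

variable {H : Type*} [NormedAddCommGroup H] [InnerProductSpace ℂ H]

/-- If `T - c` is nonnegative for some `c > 0` then `T` is invertible. -/
lemma isUnit_of_sub_nonneg [CompleteSpace H] {T : H →L[ℂ] H} {c : ℝ} (hc : 0 < c)
    (hT : 0 ≤ T - algebraMap ℝ (H →L[ℂ] H) c) : IsUnit T := by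
  have h := fun {t : ℝ} => spectrum_nonneg_of_nonneg (𝕜 := ℝ) (x := t) hT
  by_contra hu
  have h1 : (-c) ∈ spectrum ℝ (T - algebraMap ℝ (H →L[ℂ] H) c) := by
    have h2 : algebraMap ℝ (H →L[ℂ] H) (-c) - (T - algebraMap ℝ (H →L[ℂ] H) c) = -T := by
      rw [map_neg]; abel
    rwa [spectrum.mem_iff, h2, IsUnit.neg_iff]
  have := h h1
  linarith

/-- A self-adjoint operator taking a negative value of its quadratic form on some vector has a
negative number in its spectrum. -/
lemma exists_neg_mem_spectrum [CompleteSpace H] {K : H →L[ℂ] H} (hK : IsSelfAdjoint K) {x : H}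
    (hx : (⟪K x, x⟫_ℂ).re < 0) : ∃ μ : ℝ, μ < 0 ∧ μ ∈ spectrum ℝ K := by
  by_contra! h
  have h0 : 0 ≤ K := by
    rw [StarOrderedRing.nonneg_iff_spectrum_nonneg (R := ℝ) K hK]
    intro μ hμ
    by_contra! hlt
    exact h μ hlt hμ
  rw [ContinuousLinearMap.nonneg_iff_isPositive] at h0
  have := h0.re_inner_nonneg_left x
  simp only [RCLike.re_eq_complex_re] at this
  linarith

/-- A real point of the spectrum of `P - C`, with `C` compact, at which `P` is invertible,
is an eigenvalue. -/
lemma exists_eigenvector_of_mem_spectrum [CompleteSpace H] {P C : H →L[ℂ] H} (hC : IsCompactOperator C)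
    {μ : ℝ} (hP : IsUnit (P - algebraMap ℝ (H →L[ℂ] H) μ)) (hμ : μ ∈ spectrum ℝ (P - C)) :
    ∃ x : H, x ≠ 0 ∧ (P - C) x = μ • x := by
  obtain ⟨u, hu⟩ := hP
  -- `P - C - μ = (P - μ)(1 - G C)`, so the Fredholm alternative for the compact operator `G C` at 1
  -- decides the matter.
  set G : H →L[ℂ] H := ↑u⁻¹
  have hT : IsCompactOperator (G * C : H →L[ℂ] H) := hC.clm_comp G
  rcases hT.hasEigenvalue_or_mem_resolventSet (μ := (1 : ℂ)) one_ne_zero with h | h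
  · obtain ⟨x, hx⟩ := h.exists_hasEigenvector
    refine ⟨x, hx.2, ?_⟩
    have h1 : G (C x) = x := by simpa using hx.apply_eq_smul
    have h2 : (u : H →L[ℂ] H) (G (C x)) = C x := by
      rw [← mul_apply_eq_comp, Units.mul_inv]; rfl
    rw [h1, hu] at h2
    simp only [sub_apply] at h2 ⊢
    rw [← h2, Algebra.algebraMap_eq_smul_one]
    simp
  · exfalso
    rw [spectrum.mem_iff] at hμ
    apply hμ
    have h3 : IsUnit ((1 : H →L[ℂ] H) - G * C) := by
      simpa [spectrum.mem_resolventSet_iff] using h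
    have h4 : algebraMap ℝ (H →L[ℂ] H) μ - (P - C) = -((u : H →L[ℂ] H) * (1 - G * C)) := by
      rw [mul_sub, mul_one, ← mul_assoc, Units.mul_inv, one_mul, hu]; abel
    rw [h4]
    exact (u.isUnit.mul h3).neg

/-- If `L ≥ c > 0`, `C` is compact and self-adjoint, and `L - C` is negative in some direction, then
`L (L - C)` has a negative eigenvalue. -/
lemma exists_neg_eigenvalue_mul [CompleteSpace H] {L C : H →L[ℂ] H} {c : ℝ} (hc : 0 < c)
    (hL : 0 ≤ L - algebraMap ℝ (H →L[ℂ] H) c) (hC : IsCompactOperator C) (hCs : IsSelfAdjoint C)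
    {x : H} (hx : (⟪(L - C) x, x⟫_ℂ).re < 0) :
    ∃ lam : ℝ, 0 < lam ∧ ∃ U : H, U ≠ 0 ∧ L ((L - C) U) = -(lam ^ 2) • U := by
  have hL0 : 0 ≤ L := by
    have h : 0 ≤ algebraMap ℝ (H →L[ℂ] H) c := by
      rw [Algebra.algebraMap_eq_smul_one]
      exact smul_nonneg hc.le zero_le_one
    have := add_nonneg hL h
    simpa using this
  have hLu : IsUnit L := isUnit_of_sub_nonneg hc hL
  set S := CFC.sqrt L
  have hS : S * S = L := CFC.sqrt_mul_sqrt_self L hL0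
  have hS0 : 0 ≤ S := CFC.sqrt_nonneg L
  have hSs : IsSelfAdjoint S := hS0.isSelfAdjoint
  have hLs : IsSelfAdjoint L := hL0.isSelfAdjoint
  obtain ⟨v, hv⟩ := (CFC.isUnit_sqrt_iff L hL0).2 hLu
  change (v : H →L[ℂ] H) = S at hv
  have hK : IsSelfAdjoint (S * (L - C) * S) := by
    have := (hLs.sub hCs).conjugate S
    rwa [hSs.star_eq] at this
  have hKx : (⟪(S * (L - C) * S) ((↑v⁻¹ : H →L[ℂ] H) x), (↑v⁻¹ : H →L[ℂ] H) x⟫_ℂ).re < 0 := by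
    have h1 : S ((↑v⁻¹ : H →L[ℂ] H) x) = x := by
      rw [← hv, ← mul_apply_eq_comp, Units.mul_inv]; rfl
    have h2 : ∀ y z, ⟪S y, z⟫_ℂ = ⟪y, S z⟫_ℂ := fun y z => hSs.isSymmetric y z
    rw [mul_apply_eq_comp, mul_apply_eq_comp, h2, h1]
    exact hx
  obtain ⟨μ, hμ0, hμ⟩ := exists_neg_mem_spectrum hK hKx
  -- `L²` is nonnegative and `S C S` is compact, so the negative number `μ` is an eigenvalue;
  -- conjugation by `S` then turns `y` into `U = S y`.
  have hdec : S * (L - C) * S = L * L - S * C * S := by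
    rw [mul_sub, sub_mul]
    congr 1
    rw [← hS]; noncomm_ring
  have hcomp : IsCompactOperator (S * C * S : H →L[ℂ] H) := (hC.clm_comp S).comp_clm S
  have hP : IsUnit (L * L - algebraMap ℝ (H →L[ℂ] H) μ) := by
    apply isUnit_of_sub_nonneg (c := -μ) (by linarith)
    have h : 0 ≤ star L * L := star_mul_self_nonneg L
    rw [hLs.star_eq] at h
    simpa using h
  rw [hdec] at hμ
  obtain ⟨y, hy0, hy⟩ := exists_eigenvector_of_mem_spectrum hcomp hP hμ
  rw [← hdec] at hy
  refine ⟨√(-μ), Real.sqrt_pos.2 (by linarith), S y, ?_, ?_⟩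
  · intro h
    rw [mul_apply_eq_comp, h, map_zero] at hy
    rcases smul_eq_zero.1 hy.symm with h | h
    · exact hμ0.ne h
    · exact hy0 h
  · rw [Real.sq_sqrt (by linarith), neg_neg]
    calc L ((L - C) (S y)) = S ((S * (L - C) * S) y) := by rw [← hS]; rfl
      _ = μ • S y := by
        rw [hy, RCLike.real_smul_eq_coe_smul (K := ℂ), map_smul]
        exact (RCLike.real_smul_eq_coe_smul (K := ℂ) _ _).symm

/-! ### Eigenvalues near the one-site problem -/

/-- The scalar part of the eigenvalue estimate. -/
lemma abs_sq_sub_le_of_projected {u w r a b : ℂ} {p lam δ N : ℝ} (hp2 : p ^ 2 ≤ 2)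
    (hlam : 0 < lam) (hlam7 : lam ≤ 7) (hδ : 0 ≤ δ) (hN : N ≤ 2 * (‖u‖ + ‖w‖)) (hN0 : 0 < N)
    (h1 : lam * w = (2 - p ^ 2) * u - r) (h2 : p ^ 2 * w - lam * u = p ^ 2 * a - lam * b)
    (hr : ‖r‖ ≤ δ * N) (ha : ‖a‖ ≤ 5 * δ * N) (hb : ‖b‖ ≤ 5 * δ * N) :
    |lam ^ 2 - p ^ 2 * (2 - p ^ 2)| ≤ 94 * (p ^ 2 + lam) * δ := by
  set D := |lam ^ 2 - p ^ 2 * (2 - p ^ 2)| with hD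
  have hDn : ∀ z : ℂ, ‖((lam : ℂ) ^ 2 - p ^ 2 * (2 - p ^ 2)) * z‖ = D * ‖z‖ := by
    intro z
    rw [norm_mul, hD, ← Real.norm_eq_abs, ← Complex.norm_real]
    push_cast; rfl
  have hcast : ∀ t : ℝ, 0 ≤ t → ‖(t : ℂ)‖ = t := fun t ht => by simp [abs_of_nonneg ht]
  have hnp : ‖(p : ℂ) ^ 2‖ = p ^ 2 := by
    rw [norm_pow, Complex.norm_real, Real.norm_eq_abs, sq_abs]
  have hnl : ‖(lam : ℂ)‖ = lam := hcast lam hlam.le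
  have hn2 : ‖(2 : ℂ) - p ^ 2‖ ≤ 2 := by
    have : (2 : ℂ) - p ^ 2 = ((2 - p ^ 2 : ℝ) : ℂ) := by push_cast; rfl
    rw [this, hcast _ (by linarith)]
    nlinarith [sq_nonneg p]
  have hδN : 0 ≤ δ * N := by positivity
  have hx : ‖(p : ℂ) ^ 2 * a‖ ≤ p ^ 2 * (5 * δ * N) := by
    rw [norm_mul, hnp]; gcongr
  have hy : ‖(lam : ℂ) * b‖ ≤ lam * (5 * δ * N) := by
    rw [norm_mul, hnl]; gcongr
  have hz : ‖(lam : ℂ) * r‖ ≤ lam * (δ * N) := by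
    rw [norm_mul, hnl]; gcongr
  have hz' : ‖(p : ℂ) ^ 2 * r‖ ≤ p ^ 2 * (δ * N) := by
    rw [norm_mul, hnp]; gcongr
  have hxy : ‖(p : ℂ) ^ 2 * a - lam * b‖ ≤ (p ^ 2 + lam) * (5 * δ * N) :=
    (norm_sub_le _ _).trans (by linarith)
  -- Cramer's rule: `h1` and `h2` form a 2×2 system in `u`, `w` with determinant `lam² - p² (2 -
  -- p²)` up to sign.
  have hw : D * ‖w‖ ≤ 2 * ((p ^ 2 + lam) * (5 * δ * N)) + lam * (δ * N) := by
    rw [← hDn]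
    have : ((lam : ℂ) ^ 2 - p ^ 2 * (2 - p ^ 2)) * w
        = -((2 - p ^ 2) * (p ^ 2 * a - lam * b)) - lam * r := by
      linear_combination (lam : ℂ) * h1 - (2 - (p : ℂ) ^ 2) * h2
    rw [this]
    refine (norm_sub_le _ _).trans (add_le_add ?_ hz)
    rw [norm_neg, norm_mul]
    exact mul_le_mul hn2 hxy (norm_nonneg _) (by norm_num)
  have hu : D * ‖u‖ ≤ p ^ 2 * (δ * N) + 7 * ((p ^ 2 + lam) * (5 * δ * N)) := by
    rw [← hDn]
    have : ((lam : ℂ) ^ 2 - p ^ 2 * (2 - p ^ 2)) * u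
        = -((p : ℂ) ^ 2 * r) - lam * (p ^ 2 * a - lam * b) := by
      linear_combination (p : ℂ) ^ 2 * h1 - (lam : ℂ) * h2
    rw [this]
    refine (norm_sub_le _ _).trans (add_le_add (by rwa [norm_neg]) ?_)
    rw [norm_mul, hnl]
    exact mul_le_mul hlam7 hxy (norm_nonneg _) (by norm_num)
  have hD0 : 0 ≤ D := abs_nonneg _
  have hDN : D * N ≤ 94 * (p ^ 2 + lam) * δ * N := by
    have h3 : D * N ≤ 2 * (D * ‖u‖ + D * ‖w‖) := by
      calc D * N ≤ D * (2 * (‖u‖ + ‖w‖)) := by gcongr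
        _ = _ := by ring
    nlinarith [mul_nonneg (sq_nonneg p) hδN, mul_nonneg hlam.le hδN]
  exact le_of_mul_le_mul_right hDN hN0

/-- A positive eigenvalue of the stability problem for a small perturbation of the one-site
soliton satisfies the dispersion relation `lam ^ 2 = p ^ 2 (2 - p ^ 2)` up to an error that is
controlled for small `p` thanks to the zero mode `f`. -/
lemma abs_sq_sub_le_of_perturbation {e f U W r s : H} {p lam δ : ℝ} (he : ‖e‖ = 1)
    (hp2 : p ^ 2 ≤ 2) (hlam : 0 < lam) (hδ : 0 ≤ δ) (hδ4 : δ ≤ 1 / 4) (hne : U ≠ 0 ∨ W ≠ 0)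
    (hU : ((1 + p ^ 2 : ℝ) : ℂ) • U - (3 * ⟪e, U⟫_ℂ) • e + r = -((lam : ℂ) • W))
    (hW : ((1 + p ^ 2 : ℝ) : ℂ) • W - ⟪e, W⟫_ℂ • e + s = (lam : ℂ) • U)
    (hr : ‖r‖ ≤ δ * ‖U‖) (hs : ‖s‖ ≤ δ * ‖W‖)
    (hf : p ^ 2 * ⟪f, W⟫_ℂ = lam * ⟪f, U⟫_ℂ) (hfe : ‖⟪f, e⟫_ℂ - 1‖ ≤ δ) (hf2 : ‖f‖ ≤ 2) :
    |lam ^ 2 - p ^ 2 * (2 - p ^ 2)| ≤ 94 * (p ^ 2 + lam) * δ := by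
  set u := ⟪e, U⟫_ℂ with hu
  set w := ⟪e, W⟫_ℂ with hw
  set N := ‖U‖ + ‖W‖ with hN
  have hN0 : 0 < N := by
    rcases hne with h | h
    · have := norm_pos_iff.2 h; positivity
    · have := norm_pos_iff.2 h; positivity
  have hee : ⟪e, e⟫_ℂ = 1 := by rw [inner_self_eq_norm_sq_to_K, he]; simp
  have hu1 : ‖u‖ ≤ ‖U‖ := by simpa [he] using norm_inner_le_norm (𝕜 := ℂ) e U
  have hw1 : ‖w‖ ≤ ‖W‖ := by simpa [he] using norm_inner_le_norm (𝕜 := ℂ) e W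
  have hUN : ‖U‖ ≤ N := by have := norm_nonneg W; linarith
  have hWN : ‖W‖ ≤ N := by have := norm_nonneg U; linarith
  have hrN : ‖r‖ ≤ δ * N := hr.trans (by gcongr)
  have hsN : ‖s‖ ≤ δ * N := hs.trans (by gcongr)
  have hnp : ‖((1 + p ^ 2 : ℝ) : ℂ)‖ = 1 + p ^ 2 := by
    rw [Complex.norm_real, Real.norm_of_nonneg (by positivity)]
  have hnl : ‖(lam : ℂ)‖ = lam := by rw [Complex.norm_real, Real.norm_of_nonneg hlam.le]
  -- a priori bound on the eigenvalue
  have hlam7 : lam ≤ 7 := by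
    have h1 : lam * ‖W‖ ≤ 7 * ‖U‖ := by
      have : lam * ‖W‖ = ‖((1 + p ^ 2 : ℝ) : ℂ) • U - (3 * u) • e + r‖ := by
        rw [hU, norm_neg, norm_smul, hnl]
      rw [this]
      calc _ ≤ ‖((1 + p ^ 2 : ℝ) : ℂ) • U‖ + ‖(3 * u) • e‖ + ‖r‖ :=
            (norm_add_le _ _).trans (by gcongr; exact norm_sub_le _ _)
        _ = (1 + p ^ 2) * ‖U‖ + 3 * ‖u‖ + ‖r‖ := by
            rw [norm_smul, norm_smul, hnp, he, norm_mul]; norm_num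
        _ ≤ _ := by nlinarith [norm_nonneg U]
    have h2 : lam * ‖U‖ ≤ 7 * ‖W‖ := by
      have : lam * ‖U‖ = ‖((1 + p ^ 2 : ℝ) : ℂ) • W - w • e + s‖ := by
        rw [hW, norm_smul, hnl]
      rw [this]
      calc _ ≤ ‖((1 + p ^ 2 : ℝ) : ℂ) • W‖ + ‖w • e‖ + ‖s‖ :=
            (norm_add_le _ _).trans (by gcongr; exact norm_sub_le _ _)
        _ = (1 + p ^ 2) * ‖W‖ + ‖w‖ + ‖s‖ := by
            rw [norm_smul, norm_smul, hnp, he, mul_one]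
        _ ≤ _ := by nlinarith [norm_nonneg W]
    have h3 : lam * N ≤ 7 * N := by rw [hN]; linarith
    exact le_of_mul_le_mul_right h3 hN0
  -- components orthogonal to `e`
  set U' := U - u • e with hU'
  set W' := W - w • e with hW'
  have heU : ⟪U', e⟫_ℂ = 0 := by
    rw [hU', inner_sub_left, inner_smul_left, hee, mul_one, hu, inner_conj_symm, sub_self]
  have heW : ⟪W', e⟫_ℂ = 0 := by
    rw [hW', inner_sub_left, inner_smul_left, hee, mul_one, hw, inner_conj_symm, sub_self]
  have hUd : U = U' + u • e := by rw [hU']; abel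
  have hWd : W = W' + w • e := by rw [hW']; abel
  -- Pairing with `U'` here and with `W'` in `h2` produces cross terms in `lam` of opposite sign.
  -- Their sum bounds `‖U'‖² + ‖W'‖²` with no constant depending on `lam`.
  have h1 : (1 + p ^ 2) * ‖U'‖ ^ 2 + (⟪U', r⟫_ℂ).re = -(lam * (⟪U', W'⟫_ℂ).re) := by
    have h := congrArg (fun x => (⟪U', x⟫_ℂ).re) hU
    have e1 : ⟪U', U⟫_ℂ = ((‖U'‖ ^ 2 : ℝ) : ℂ) := by
      rw [hUd, inner_add_right, inner_smul_right, heU, inner_self_eq_norm_sq_to_K]; simp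
    have e2 : ⟪U', W⟫_ℂ = ⟪U', W'⟫_ℂ := by
      rw [hWd, inner_add_right, inner_smul_right, heU]; simp
    simp only [inner_add_right, inner_sub_right, inner_smul_right, inner_neg_right, heU, e1, e2,
      mul_zero, sub_zero, Complex.add_re, Complex.neg_re, Complex.re_ofReal_mul,
      Complex.ofReal_re] at h
    exact h
  have h2 : (1 + p ^ 2) * ‖W'‖ ^ 2 + (⟪W', s⟫_ℂ).re = lam * (⟪U', W'⟫_ℂ).re := by
    have h := congrArg (fun x => (⟪W', x⟫_ℂ).re) hW
    have e1 : ⟪W', W⟫_ℂ = ((‖W'‖ ^ 2 : ℝ) : ℂ) := by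
      rw [hWd, inner_add_right, inner_smul_right, heW, inner_self_eq_norm_sq_to_K]; simp
    have e2 : ⟪W', U⟫_ℂ = ⟪W', U'⟫_ℂ := by
      rw [hUd, inner_add_right, inner_smul_right, heW]; simp
    have e3 : (⟪W', U'⟫_ℂ).re = (⟪U', W'⟫_ℂ).re := by
      rw [← inner_conj_symm, Complex.conj_re]
    simp only [inner_add_right, inner_sub_right, inner_smul_right, heW, e1, e2,
      mul_zero, sub_zero, Complex.add_re, Complex.re_ofReal_mul,
      Complex.ofReal_re, e3] at h
    exact h
  have hre : ∀ x y : H, -(‖x‖ * ‖y‖) ≤ (⟪x, y⟫_ℂ).re := fun x y => by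
    have := Complex.abs_re_le_norm ⟪x, y⟫_ℂ
    have h3 := norm_inner_le_norm (𝕜 := ℂ) x y
    linarith [neg_abs_le (⟪x, y⟫_ℂ).re]
  have ht : ‖U'‖ + ‖W'‖ ≤ 2 * (δ * N) := by
    have ha : 0 ≤ ‖U'‖ := norm_nonneg _
    have hb : 0 ≤ ‖W'‖ := norm_nonneg _
    have h3 := hre U' r
    have h4 := hre W' s
    have h5 : ‖U'‖ * ‖r‖ ≤ ‖U'‖ * (δ * N) := by gcongr
    have h6 : ‖W'‖ * ‖s‖ ≤ ‖W'‖ * (δ * N) := by gcongr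
    have h7 : ‖U'‖ ^ 2 + ‖W'‖ ^ 2 ≤ (‖U'‖ + ‖W'‖) * (δ * N) := by
      nlinarith [mul_nonneg (sq_nonneg p) (sq_nonneg ‖U'‖), mul_nonneg (sq_nonneg p) (sq_nonneg ‖W'‖)]
    by_contra! h8
    have h9 : 0 ≤ δ * N := by positivity
    nlinarith [sq_nonneg (‖U'‖ - ‖W'‖)]
  have hUt : ‖U'‖ ≤ 2 * (δ * N) := by linarith [norm_nonneg W']
  have hWt : ‖W'‖ ≤ 2 * (δ * N) := by linarith [norm_nonneg U']
  have hNuw : N ≤ 2 * (‖u‖ + ‖w‖) := by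
    have h3 : ‖U‖ ≤ ‖U'‖ + ‖u‖ := by
      calc ‖U‖ = ‖U' + u • e‖ := by rw [← hUd]
        _ ≤ _ := (norm_add_le _ _).trans (by rw [norm_smul, he, mul_one])
    have h4 : ‖W‖ ≤ ‖W'‖ + ‖w‖ := by
      calc ‖W‖ = ‖W' + w • e‖ := by rw [← hWd]
        _ ≤ _ := (norm_add_le _ _).trans (by rw [norm_smul, he, mul_one])
    nlinarith
  -- components along `e`
  have h0 : lam * w = (2 - p ^ 2) * u - ⟪e, r⟫_ℂ := by
    have h := congrArg (fun x => ⟪e, x⟫_ℂ) hU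
    simp only [inner_add_right, inner_sub_right, inner_smul_right, inner_neg_right, hee,
      ← hu, ← hw] at h
    push_cast at h
    linear_combination h
  have her : ‖⟪e, r⟫_ℂ‖ ≤ δ * N := by
    refine (norm_inner_le_norm (𝕜 := ℂ) e r).trans ?_
    rwa [he, one_mul]
  -- Replacing the site coordinate by the pairing with `f` costs `δ N` from `⟨f, e⟩ ≠ 1` and `4 δ N`
  -- from the orthogonal component.
  have hproj : ∀ x x' : H, ∀ z : ℂ, x = x' + z • e → ‖x'‖ ≤ 2 * (δ * N) → ‖z‖ ≤ N →
      ‖z - ⟪f, x⟫_ℂ‖ ≤ 5 * δ * N := by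
    intro x x' z hx hx' hz
    have : z - ⟪f, x⟫_ℂ = -(z * (⟪f, e⟫_ℂ - 1)) - ⟪f, x'⟫_ℂ := by
      rw [hx, inner_add_right, inner_smul_right]; ring
    rw [this]
    refine (norm_sub_le _ _).trans ?_
    rw [norm_neg, norm_mul]
    have h3 : ‖z‖ * ‖⟪f, e⟫_ℂ - 1‖ ≤ N * δ := by gcongr
    have h4 : ‖⟪f, x'⟫_ℂ‖ ≤ 2 * (2 * (δ * N)) :=
      (norm_inner_le_norm (𝕜 := ℂ) f x').trans (by gcongr)
    linarith
  refine abs_sq_sub_le_of_projected (a := w - ⟪f, W⟫_ℂ) (b := u - ⟪f, U⟫_ℂ) hp2 hlam hlam7 hδ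
    hNuw hN0 h0 ?_ her (hproj W W' w hWd hWt (hw1.trans hWN)) (hproj U U' u hUd hUt (hu1.trans hUN))
  linear_combination hf

/-! ### The lattice operators on `ℓ²(ℤ)` -/

lemma memlp_comp_add (x : ComplexSeq) (k : ℤ) : Memℓp (fun m : ℤ => x (m + k)) 2 := by
  have h := (lp.memℓp x).summable (by norm_num)
  have h1 : Summable ((fun m => ‖x m‖ ^ (2 : ENNReal).toReal) ∘ Equiv.addRight k) :=
    (Equiv.summable_iff _).2 h
  exact memℓp_gen h1

/-- The shift `(shift k x) m = x (m + k)` on square-summable sequences. -/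
noncomputable def shift (k : ℤ) : ComplexSeq →L[ℂ] ComplexSeq :=
  LinearMap.mkContinuous
    { toFun := fun x => ⟨fun m => x (m + k), memlp_comp_add x k⟩
      map_add' := fun _ _ => rfl
      map_smul' := fun _ _ => rfl } 1 (by
    intro x
    rw [one_mul]
    apply lp.norm_le_of_forall_sum_le (by norm_num) (norm_nonneg _)
    intro s
    have h := lp.sum_rpow_le_norm_rpow (p := 2) (by norm_num) x (s.map (Equiv.addRight k).toEmbedding)
    refine le_trans (le_of_eq ?_) h
    rw [Finset.sum_map]
    rfl)

@[simp] lemma shift_apply (k : ℤ) (x : ComplexSeq) (m : ℤ) : shift k x m = x (m + k) := rfl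

lemma norm_shift_le (k : ℤ) (x : ComplexSeq) : ‖shift k x‖ ≤ ‖x‖ := by
  have := (shift k).le_of_opNorm_le (LinearMap.mkContinuous_norm_le _ zero_le_one _) x
  simpa using this

/-- The unit vector supported at the site `m`. -/
noncomputable abbrev site (m : ℤ) : ComplexSeq := lp.single 2 m (1 : ℂ)

lemma norm_site (m : ℤ) : ‖site m‖ = 1 := by
  rw [lp.norm_single (by norm_num)]; simp

lemma inner_site_left (m : ℤ) (x : ComplexSeq) : ⟪site m, x⟫_ℂ = x m := by
  rw [lp.inner_single_left]; simp

lemma summable_sq (ψ : RealSeq) : Summable fun m => ψ m ^ 2 := by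
  have h := (lp.memℓp ψ).summable (by norm_num)
  simpa using h

/-- Multiplication by the square of a square-summable sequence. -/
noncomputable def mulSq (ψ : RealSeq) : ComplexSeq →L[ℂ] ComplexSeq :=
  ∑' m : ℤ, ((ψ m ^ 2 : ℝ) : ℂ) • InnerProductSpace.rankOne ℂ (site m) (site m)

lemma hasSum_mulSq (ψ : RealSeq) :
    HasSum (fun m : ℤ => ((ψ m ^ 2 : ℝ) : ℂ) • InnerProductSpace.rankOne ℂ (site m) (site m))
      (mulSq ψ) := by
  apply Summable.hasSum
  apply Summable.of_norm
  refine (summable_sq ψ).congr fun m => ?_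
  rw [norm_smul, InnerProductSpace.norm_rankOne, norm_site, Complex.norm_real,
    Real.norm_of_nonneg (sq_nonneg _)]
  ring

@[simp] lemma mulSq_apply (ψ : RealSeq) (x : ComplexSeq) (n : ℤ) :
    mulSq ψ x n = (ψ n : ℂ) ^ 2 * x n := by
  have h := (hasSum_mulSq ψ).mapL
    ((innerSL ℂ (site n)).comp (ContinuousLinearMap.apply ℂ ComplexSeq x))
  have h2 := h.unique (hasSum_single n ?_)
  · simp only [ContinuousLinearMap.comp_apply, ContinuousLinearMap.apply_apply,
      innerSL_apply_apply, inner_site_left] at h2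
    rw [h2]
    simp [inner_site_left]
  · intro m hm
    simp [inner_site_left, hm.symm]

/-- The defining series converges in operator norm because `∑ ψ_m²` is finite, and its partial sums
have finite rank. -/
lemma isCompactOperator_mulSq (ψ : RealSeq) : IsCompactOperator (mulSq ψ) := by
  have h : HasSum _ _ := hasSum_mulSq ψ
  refine isCompactOperator_of_tendsto h (Eventually.of_forall fun s => ?_)
  have : (∑ m ∈ s, ((ψ m ^ 2 : ℝ) : ℂ) • InnerProductSpace.rankOne ℂ (site m) (site m)) ∈
      compactOperator (RingHom.id ℂ) ComplexSeq ComplexSeq := by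
    refine Submodule.sum_mem _ fun m _ => Submodule.smul_mem _ _ ?_
    change IsCompactOperator (InnerProductSpace.rankOne ℂ (site m) (site m))
    rw [InnerProductSpace.rankOne_def']
    exact (isCompactOperator_of_locallyCompactSpace_dom (innerSL ℂ (site m))).clm_comp
      (ContinuousLinearMap.toSpanSingleton ℂ (site m))
  exact this

lemma isSelfAdjoint_mulSq (ψ : RealSeq) : IsSelfAdjoint (mulSq ψ) := by
  rw [ContinuousLinearMap.isSelfAdjoint_iff_isSymmetric]
  intro x y
  change ⟪mulSq ψ x, y⟫_ℂ = ⟪x, mulSq ψ y⟫_ℂ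
  rw [lp.inner_eq_tsum, lp.inner_eq_tsum]
  congr 1; ext m
  simp; ring

lemma inner_shift_left (k : ℤ) (x y : ComplexSeq) :
    ⟪shift k x, y⟫_ℂ = ⟪x, shift (-k) y⟫_ℂ := by
  rw [lp.inner_eq_tsum, lp.inner_eq_tsum, ← (Equiv.addRight k).tsum_eq (fun m => ⟪x m, shift (-k) y m⟫_ℂ)]
  congr 1; ext m
  simp

/-- The nonnegative operator `-ε Δ + 1 + p²`. -/
noncomputable def freeOp (ε p : ℝ) : ComplexSeq →L[ℂ] ComplexSeq :=
  ((2 * ε + 1 + p ^ 2 : ℝ) : ℂ) • 1 - (ε : ℂ) • (shift 1 + shift (-1))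

lemma freeOp_apply (ε p : ℝ) (x : ComplexSeq) (m : ℤ) :
    freeOp ε p x m = (2 * ε + 1 + p ^ 2) * x m - ε * (x (m + 1) + x (m - 1)) := by
  have : freeOp ε p x m = ((2 * ε + 1 + p ^ 2 : ℝ) : ℂ) * x m - ε * (x (m + 1) + x (m - 1)) := rfl
  rw [this]; push_cast; rfl

/-- `L₋(p)` as a bounded operator. -/
noncomputable def opMinus (ε p : ℝ) (ψ : RealSeq) : ComplexSeq →L[ℂ] ComplexSeq :=
  freeOp ε p - mulSq ψ

/-- `L₊(p)` as a bounded operator. -/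
noncomputable def opPlus (ε p : ℝ) (ψ : RealSeq) : ComplexSeq →L[ℂ] ComplexSeq :=
  opMinus ε p ψ - (2 : ℂ) • mulSq ψ

lemma opMinus_apply (ε p : ℝ) (ψ : RealSeq) (x : ComplexSeq) (m : ℤ) :
    opMinus ε p ψ x m = Lminus 1 1 ε p ψ x m := by
  simp [opMinus, freeOp_apply, Lminus]
  ring

lemma opPlus_apply (ε p : ℝ) (ψ : RealSeq) (x : ComplexSeq) (m : ℤ) :
    opPlus ε p ψ x m = Lplus 1 1 ε p ψ x m := by
  simp only [opPlus, sub_apply, lp.coeFn_sub, Pi.sub_apply, opMinus_apply]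
  simp [Lminus, Lplus]
  ring

lemma isSelfAdjoint_opMinus (ε p : ℝ) (ψ : RealSeq) : IsSelfAdjoint (opMinus ε p ψ) := by
  refine IsSelfAdjoint.sub ?_ (isSelfAdjoint_mulSq ψ)
  rw [ContinuousLinearMap.isSelfAdjoint_iff_isSymmetric]
  intro x y
  change ⟪freeOp ε p x, y⟫_ℂ = ⟪x, freeOp ε p y⟫_ℂ
  simp only [freeOp, sub_apply, add_apply, smul_apply, inner_sub_left, inner_sub_right,
    inner_smul_left, inner_smul_right, inner_add_left, inner_add_right, one_apply_eq_self,
    inner_shift_left, Complex.conj_ofReal, neg_neg]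
  ring

lemma isSelfAdjoint_two_smul_mulSq (ψ : RealSeq) : IsSelfAdjoint ((2 : ℂ) • mulSq ψ) := by
  rw [two_smul]
  exact (isSelfAdjoint_mulSq ψ).add (isSelfAdjoint_mulSq ψ)

lemma isSelfAdjoint_opPlus (ε p : ℝ) (ψ : RealSeq) : IsSelfAdjoint (opPlus ε p ψ) :=
  (isSelfAdjoint_opMinus ε p ψ).sub (isSelfAdjoint_two_smul_mulSq ψ)

lemma opMinus_eq_add (ε p : ℝ) (ψ : RealSeq) :
    opMinus ε p ψ = opMinus ε 0 ψ + algebraMap ℝ (ComplexSeq →L[ℂ] ComplexSeq) (p ^ 2) := by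
  ext x m
  simp only [add_apply, lp.coeFn_add, Pi.add_apply, opMinus_apply, Algebra.algebraMap_eq_smul_one]
  simp [Lminus]
  ring

lemma opPlus_eq_add (ε p : ℝ) (ψ : RealSeq) :
    opPlus ε p ψ = opPlus ε 0 ψ + algebraMap ℝ (ComplexSeq →L[ℂ] ComplexSeq) (p ^ 2) := by
  rw [opPlus, opMinus_eq_add, opPlus]; abel

lemma re_inner_algebraMap (c : ℝ) (x : ComplexSeq) :
    (⟪algebraMap ℝ (ComplexSeq →L[ℂ] ComplexSeq) c x, x⟫_ℂ).re = c * ‖x‖ ^ 2 := by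
  rw [Algebra.algebraMap_eq_smul_one]
  have : (c • (1 : ComplexSeq →L[ℂ] ComplexSeq)) x = (c : ℂ) • x := by
    ext m; rfl
  rw [this, inner_smul_left, inner_self_eq_norm_sq_to_K, Complex.conj_ofReal]
  simp [← Complex.ofReal_pow]

lemma re_inner_opPlus (ε p : ℝ) (ψ : RealSeq) (x : ComplexSeq) :
    (⟪opPlus ε p ψ x, x⟫_ℂ).re = (⟪opPlus ε 0 ψ x, x⟫_ℂ).re + p ^ 2 * ‖x‖ ^ 2 := by
  rw [opPlus_eq_add, add_apply, inner_add_left, Complex.add_re, re_inner_algebraMap]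

/-! ### Ground state representation and signs of the quadratic forms -/

lemma hasSum_re_inner (x y : ComplexSeq) :
    HasSum (fun m => (⟪x m, y m⟫_ℂ).re) (⟪x, y⟫_ℂ).re :=
  Complex.hasSum_re (lp.hasSum_inner x y)

lemma summable_normSq (x : ComplexSeq) : Summable fun m => Complex.normSq (x m) := by
  have h := (lp.memℓp x).summable (by norm_num)
  simpa [Complex.normSq_eq_norm_sq] using h

/-- Meant for `a, b, c = x_m, x_{m+1}, x_{m-1}`, `ρ = ψ_{m-1}/ψ_m` and `ρ' = ψ_m/ψ_{m+1}`. Up to a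
telescoping difference, the summand of the form is `ε ψ_m ψ_{m+1} |x_m/ψ_m - x_{m+1}/ψ_{m+1}|²`. -/
lemma ground_state_identity {ε ρ ρ' ψ : ℝ} (hρ : ρ' ≠ 0)
    (h : 1 - ψ ^ 2 + 2 * ε = ε * (ρ'⁻¹ + ρ)) (a b c : ℂ) :
    (⟪-(ε : ℂ) * (b + c - 2 * a) + a - (ψ : ℂ) ^ 2 * a, a⟫_ℂ).re
      - ε * ((ρ * Complex.normSq a - (⟪a, c⟫_ℂ).re) - (ρ' * Complex.normSq b - (⟪b, a⟫_ℂ).re)) =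
    ε * (ρ'⁻¹ * Complex.normSq (a - ρ' * b)) := by
  have hre : ∀ z w : ℂ, (⟪z, w⟫_ℂ).re = z.re * w.re + z.im * w.im := by
    intro z w; simp; ring
  have h2 : ρ'⁻¹ * ρ' = 1 := inv_mul_cancel₀ hρ
  obtain ⟨a1, a2⟩ := a
  obtain ⟨b1, b2⟩ := b
  obtain ⟨c1, c2⟩ := c
  have hψ : ((ψ : ℂ) ^ 2).re = ψ ^ 2 := by rw [← Complex.ofReal_pow, Complex.ofReal_re]
  have hψ' : ((ψ : ℂ) ^ 2).im = 0 := by rw [← Complex.ofReal_pow, Complex.ofReal_im]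
  simp only [hre, Complex.normSq_apply]
  simp [hψ, hψ']
  linear_combination (a1 ^ 2 + a2 ^ 2) * h
    + ε * (2 * (a1 * b1 + a2 * b2) - ρ' * (b1 ^ 2 + b2 ^ 2)) * h2

lemma hasSum_comp_add_one {g : ℤ → ℝ} {a : ℝ} (h : HasSum g a) :
    HasSum (fun m => g (m + 1)) a := by
  have h1 : HasSum (g ∘ (Equiv.addRight (1 : ℤ))) a := (Equiv.hasSum_iff _).2 h
  simpa [Function.comp_def] using h1

lemma re_inner_opMinus_nonneg {ε : ℝ} (hε : 0 < ε) {ψ : RealSeq} (hst : IsStationary 1 ε ψ)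
    (hpos : ∀ m, 0 < ψ m) (x : ComplexSeq) : 0 ≤ (⟪opMinus ε 0 ψ x, x⟫_ℂ).re := by
  obtain ⟨ρ, hρ⟩ : ∃ ρ : ℤ → ℝ, ∀ m, ρ m = ψ (m - 1) / ψ m := ⟨_, fun _ => rfl⟩
  have hρ0 : ∀ m, 0 < ρ m := fun m => by rw [hρ]; exact div_pos (hpos _) (hpos _)
  have hcoef : ∀ m, 1 - ψ m ^ 2 + 2 * ε = ε * ((ρ (m + 1))⁻¹ + ρ m) := by
    intro m
    have h := hst m
    rw [sq_abs] at h
    have hm := (hpos m).ne'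
    simp only [hρ, add_sub_cancel_right, inv_div]
    field_simp
    linear_combination -h
  -- The stationary equation bounds the ratios of neighbours, so the telescoping terms are summable
  -- without any decay rate for `ψ`.
  have hρb : ∀ m, ρ m ≤ (1 + 2 * ε) / ε := by
    intro m
    rw [le_div_iff₀ hε]
    have h1 := hcoef m
    have h2 : 0 < (ρ (m + 1))⁻¹ := inv_pos.2 (hρ0 _)
    nlinarith [sq_nonneg (ψ m), mul_pos hε h2]
  let g : ℤ → ℝ := fun m => ρ m * Complex.normSq (x m) - (⟪x m, shift (-1) x m⟫_ℂ).re
  have hg : Summable g := by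
    refine Summable.sub ?_ (hasSum_re_inner x (shift (-1) x)).summable
    refine Summable.of_nonneg_of_le (fun m => mul_nonneg (hρ0 m).le (Complex.normSq_nonneg _))
      (fun m => mul_le_mul_of_nonneg_right (hρb m) (Complex.normSq_nonneg _))
      ((summable_normSq x).mul_left _)
  have hg1 : HasSum (fun m => g (m + 1)) (∑' m, g m) :=
    hasSum_comp_add_one hg.hasSum
  have hz := (hg.hasSum.sub hg1).mul_left ε
  have hT := (hasSum_re_inner (opMinus ε 0 ψ x) x).sub hz
  rw [sub_self, mul_zero, sub_zero] at hT
  refine hT.nonneg fun m => ?_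
  have hr := hρ0 (m + 1)
  have key : (⟪opMinus ε 0 ψ x m, x m⟫_ℂ).re - ε * (g m - g (m + 1)) =
      ε * ((ρ (m + 1))⁻¹ * Complex.normSq (x m - ρ (m + 1) * x (m + 1))) := by
    rw [opMinus_apply]
    simp only [g, Lminus, shift_apply, ← sub_eq_add_neg, add_sub_cancel_right]
    have h := ground_state_identity hr.ne' (hcoef m) (x m) (x (m + 1)) (x (m - 1))
    rw [← h]
    push_cast
    simp
  rw [key]
  have := inv_pos.2 hr
  have := Complex.normSq_nonneg (x m - ρ (m + 1) * x (m + 1))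
  positivity


/-- The ground state representation: `L₋(0)` is nonnegative, because it annihilates a positive
sequence. -/
lemma opMinus_nonneg {ε : ℝ} (hε : 0 < ε) {ψ : RealSeq} (hst : IsStationary 1 ε ψ)
    (hpos : ∀ m, 0 < ψ m) : 0 ≤ opMinus ε 0 ψ := by
  rw [ContinuousLinearMap.nonneg_iff_isPositive, ContinuousLinearMap.isPositive_def']
  exact ⟨isSelfAdjoint_opMinus ε 0 ψ, re_inner_opMinus_nonneg hε hst hpos⟩

/-- A real sequence regarded as a complex one. -/
noncomputable def toComplex (ψ : RealSeq) : ComplexSeq :=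
  ⟨fun m => (ψ m : ℂ), (lp.memℓp ψ).mono' fun m => by simp⟩

@[simp] lemma toComplex_apply (ψ : RealSeq) (m : ℤ) : toComplex ψ m = (ψ m : ℂ) := rfl

lemma norm_toComplex (ψ : RealSeq) : ‖toComplex ψ‖ = ‖ψ‖ := by
  apply le_antisymm
  · exact lp.norm_mono (by norm_num) fun m => by simp
  · exact lp.norm_mono (by norm_num) fun m => by simp

lemma opMinus_toComplex {ε : ℝ} {ψ : RealSeq} (hst : IsStationary 1 ε ψ) :
    opMinus ε 0 ψ (toComplex ψ) = 0 := by
  ext m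
  rw [opMinus_apply]
  have h := congrArg (fun t : ℝ => (t : ℂ)) (hst m)
  simp only [sq_abs] at h
  push_cast at h
  simp only [Lminus, toComplex_apply, lp.coeFn_zero, Pi.zero_apply]
  push_cast
  linear_combination -h

/-- `L₊(0) = L₋(0) - 2ψ²` and `L₋(0)ψ = 0`, so the value is `-2 ∑ ψ_m⁴`. -/
lemma re_inner_opPlus_toComplex_neg {ε : ℝ} {ψ : RealSeq} (hst : IsStationary 1 ε ψ)
    (hpos : ∀ m, 0 < ψ m) : (⟪opPlus ε 0 ψ (toComplex ψ), toComplex ψ⟫_ℂ).re < 0 := by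
  have h : opPlus ε 0 ψ (toComplex ψ) = -((2 : ℝ) : ℂ) • mulSq ψ (toComplex ψ) := by
    rw [opPlus, sub_apply, opMinus_toComplex hst, zero_sub, smul_apply, neg_smul]
    push_cast; rfl
  have hs := hasSum_re_inner (mulSq ψ (toComplex ψ)) (toComplex ψ)
  have ht : ∀ m, (⟪mulSq ψ (toComplex ψ) m, toComplex ψ m⟫_ℂ).re = ψ m ^ 4 := by
    intro m
    have : ⟪mulSq ψ (toComplex ψ) m, toComplex ψ m⟫_ℂ = ((ψ m ^ 4 : ℝ) : ℂ) := by
      simp; ring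
    rw [this, Complex.ofReal_re]
  have h4 : ∀ m, 0 < ψ m ^ 4 := fun m => pow_pos (hpos m) 4
  simp only [ht] at hs
  have hp : 0 < (⟪mulSq ψ (toComplex ψ), toComplex ψ⟫_ℂ).re := by
    rw [← hs.tsum_eq]
    exact hs.summable.tsum_pos (fun m => (h4 m).le) 0 (h4 0)
  rw [h, inner_smul_left, ← Complex.ofReal_neg, Complex.conj_ofReal, Complex.re_ofReal_mul]
  linarith

/-! ### The instability threshold -/

/-- The stability problem in terms of bounded operators. -/
lemma isStabilityEigenvalue_iff {ε p : ℝ} {ψ : RealSeq} {z : ℂ} :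
    IsStabilityEigenvalue 1 1 ε p ψ z ↔ ∃ U W : ComplexSeq, (U ≠ 0 ∨ W ≠ 0) ∧
      opPlus ε p ψ U = -(z • W) ∧ opMinus ε p ψ W = z • U := by
  have h1 : ∀ U W : ComplexSeq, opPlus ε p ψ U = -(z • W) ↔
      ∀ m, Lplus 1 1 ε p ψ U m = -z * W m := by
    intro U W
    simp only [← opPlus_apply, lp.ext_iff, funext_iff, ← neg_smul]
    rfl
  have h2 : ∀ U W : ComplexSeq, opMinus ε p ψ W = z • U ↔
      ∀ m, Lminus 1 1 ε p ψ W m = z * U m := by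
    intro U W
    simp only [← opMinus_apply, lp.ext_iff, funext_iff]
    rfl
  simp only [IsStabilityEigenvalue, h1, h2]

/-- Time reversal: `(U, W)` becomes `(U, -W)`. -/
lemma IsStabilityEigenvalue.neg {ε p : ℝ} {ψ : RealSeq} {z : ℂ}
    (h : IsStabilityEigenvalue 1 1 ε p ψ z) : IsStabilityEigenvalue 1 1 ε p ψ (-z) := by
  rw [isStabilityEigenvalue_iff] at h ⊢
  obtain ⟨U, W, hne, h1, h2⟩ := h
  refine ⟨U, -W, ?_, by simpa using h1, by simpa using h2⟩
  simpa using hne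

/-- The negative of the bottom of the spectrum of `L₊(0)`. -/
noncomputable def thresholdSq (ε : ℝ) (ψ : RealSeq) : ℝ :=
  ⨆ x : ComplexSeq, -(⟪opPlus ε 0 ψ x, x⟫_ℂ).re / ‖x‖ ^ 2

lemma neg_re_inner_div_le (ε : ℝ) (ψ : RealSeq) (x : ComplexSeq) :
    -(⟪opPlus ε 0 ψ x, x⟫_ℂ).re / ‖x‖ ^ 2 ≤ thresholdSq ε ψ := by
  refine le_ciSup (f := fun x : ComplexSeq => -(⟪opPlus ε 0 ψ x, x⟫_ℂ).re / ‖x‖ ^ 2)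
    ⟨‖opPlus ε 0 ψ‖, ?_⟩ x
  rintro _ ⟨y, rfl⟩
  refine div_le_of_le_mul₀ (sq_nonneg _) (norm_nonneg _) ?_
  have h1 := Complex.abs_re_le_norm ⟪opPlus ε 0 ψ y, y⟫_ℂ
  have h2 := norm_inner_le_norm (𝕜 := ℂ) (opPlus ε 0 ψ y) y
  have h3 := (opPlus ε 0 ψ).le_opNorm y
  have h4 := neg_le_abs (⟪opPlus ε 0 ψ y, y⟫_ℂ).re
  nlinarith [mul_le_mul_of_nonneg_right h3 (norm_nonneg y)]

lemma re_inner_opPlus_add_nonneg (ε : ℝ) (ψ : RealSeq) (x : ComplexSeq) :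
    0 ≤ (⟪opPlus ε 0 ψ x, x⟫_ℂ).re + thresholdSq ε ψ * ‖x‖ ^ 2 := by
  rcases eq_or_ne x 0 with rfl | hx
  · simp
  have h := neg_re_inner_div_le ε ψ x
  rw [div_le_iff₀ (by have := norm_pos_iff.2 hx; positivity)] at h
  linarith

lemma exists_re_inner_opPlus_neg {ε t : ℝ} {ψ : RealSeq} (ht0 : 0 ≤ t)
    (ht : t < thresholdSq ε ψ) :
    ∃ x : ComplexSeq, (⟪opPlus ε 0 ψ x, x⟫_ℂ).re + t * ‖x‖ ^ 2 < 0 := by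
  obtain ⟨x, hx⟩ := exists_lt_of_lt_ciSup ht
  refine ⟨x, ?_⟩
  -- The zero vector contributes `0 / 0 = 0` to the supremum; `0 ≤ t` rules it out.
  rcases eq_or_ne x 0 with rfl | hx0
  · simp at hx; linarith
  rw [lt_div_iff₀ (by have := norm_pos_iff.2 hx0; positivity)] at hx
  linarith

lemma thresholdSq_pos {ε : ℝ} {ψ : RealSeq} (hst : IsStationary 1 ε ψ) (hpos : ∀ m, 0 < ψ m) :
    0 < thresholdSq ε ψ := by
  have h := re_inner_opPlus_toComplex_neg hst hpos
  have h1 := re_inner_opPlus_add_nonneg ε ψ (toComplex ψ)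
  by_contra! h2
  nlinarith [sq_nonneg ‖toComplex ψ‖]

lemma exists_pos_eigenvalue {ε p : ℝ} (hε : 0 < ε) {ψ : RealSeq} (hst : IsStationary 1 ε ψ)
    (hpos : ∀ m, 0 < ψ m) (hp : 0 < p ^ 2) (hpt : p ^ 2 < thresholdSq ε ψ) :
    ∃ lam : ℝ, 0 < lam ∧ IsStabilityEigenvalue 1 1 ε p ψ (lam : ℂ) := by
  obtain ⟨x, hx⟩ := exists_re_inner_opPlus_neg hp.le hpt
  rw [← re_inner_opPlus] at hx
  have hL : 0 ≤ opMinus ε p ψ - algebraMap ℝ (ComplexSeq →L[ℂ] ComplexSeq) (p ^ 2) := by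
    rw [opMinus_eq_add, add_sub_cancel_right]
    exact opMinus_nonneg hε hst hpos
  have hC : IsCompactOperator ((2 : ℂ) • mulSq ψ : ComplexSeq →L[ℂ] ComplexSeq) :=
    (isCompactOperator_mulSq ψ).smul (2 : ℂ)
  obtain ⟨lam, hlam, U, hU0, hU⟩ := exists_neg_eigenvalue_mul hp hL hC
    (isSelfAdjoint_two_smul_mulSq ψ) hx
  have hU' : opMinus ε p ψ (opPlus ε p ψ U) = -((lam : ℂ) ^ 2 • U) := by
    rw [← neg_smul, ← Complex.ofReal_pow, ← Complex.ofReal_neg]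
    exact hU
  have hl : (lam : ℂ) ≠ 0 := Complex.ofReal_ne_zero.2 hlam.ne'
  refine ⟨lam, hlam, isStabilityEigenvalue_iff.2 ⟨U, -((lam : ℂ)⁻¹ • opPlus ε p ψ U), Or.inl hU0,
    ?_, ?_⟩⟩
  · rw [smul_neg, neg_neg, smul_smul, mul_inv_cancel₀ hl, one_smul]
  · rw [map_neg, map_smul, hU', smul_neg, neg_neg, smul_smul]
    congr 1
    field_simp

/-- The form values `a = ⟨L₊U, U⟩` and `b = ⟨L₋W, W⟩` are real and satisfy `z a = -z̄ b`. Taking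
real parts gives `Re z (a + b) = 0`, while `a ≥ 0` and `b ≥ p² ‖W‖²`. -/
lemma not_isStabilityEigenvalue_of_re_pos {ε p : ℝ} (hε : 0 < ε) {ψ : RealSeq}
    (hst : IsStationary 1 ε ψ) (hpos : ∀ m, 0 < ψ m) (hp : 0 < p ^ 2)
    (hpt : thresholdSq ε ψ ≤ p ^ 2) {z : ℂ} (hz : 0 < z.re) :
    ¬ IsStabilityEigenvalue 1 1 ε p ψ z := by
  rw [isStabilityEigenvalue_iff]
  rintro ⟨U, W, hne, h1, h2⟩
  have hz0 : z ≠ 0 := fun h => by simp [h] at hz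
  have ha : 0 ≤ (⟪opPlus ε p ψ U, U⟫_ℂ).re := by
    rw [re_inner_opPlus]
    have := re_inner_opPlus_add_nonneg ε ψ U
    nlinarith [sq_nonneg ‖U‖]
  have hb : p ^ 2 * ‖W‖ ^ 2 ≤ (⟪opMinus ε p ψ W, W⟫_ℂ).re := by
    rw [opMinus_eq_add, add_apply, inner_add_left, Complex.add_re, re_inner_algebraMap]
    linarith [re_inner_opMinus_nonneg hε hst hpos W]
  have hai : (⟪opPlus ε p ψ U, U⟫_ℂ).im = 0 := by
    rw [← Complex.conj_eq_iff_im, inner_conj_symm]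
    exact ((isSelfAdjoint_opPlus ε p ψ).isSymmetric U U).symm
  have hbi : (⟪opMinus ε p ψ W, W⟫_ℂ).im = 0 := by
    rw [← Complex.conj_eq_iff_im, inner_conj_symm]
    exact ((isSelfAdjoint_opMinus ε p ψ).isSymmetric W W).symm
  set a := ⟪opPlus ε p ψ U, U⟫_ℂ with haE
  set b := ⟪opMinus ε p ψ W, W⟫_ℂ with hbE
  have e1 : a = -(starRingEnd ℂ z * ⟪W, U⟫_ℂ) := by
    rw [haE, h1, inner_neg_left, inner_smul_left]
  have e2 : b = z * ⟪W, U⟫_ℂ := by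
    have : b = starRingEnd ℂ b := (Complex.conj_eq_iff_im.2 hbi).symm
    rw [this, hbE, inner_conj_symm, h2, inner_smul_right]
  have e3 : z * a = -(starRingEnd ℂ z * b) := by rw [e1, e2]; ring
  have e4 := congrArg Complex.re e3
  simp only [Complex.mul_re, Complex.neg_re, Complex.conj_re, Complex.conj_im, hai, hbi] at e4
  have e5 : a.re + b.re = 0 := by
    have : z.re * (a.re + b.re) = 0 := by linarith
    exact (mul_eq_zero.1 this).resolve_left hz.ne'
  have hW : W = 0 := by
    have h3 : p ^ 2 * ‖W‖ ^ 2 = 0 := le_antisymm (by linarith) (by positivity)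
    simpa using (mul_eq_zero.1 h3).resolve_left hp.ne'
  have hU : U = 0 := by
    rw [hW, map_zero] at h2
    exact (smul_eq_zero.1 h2.symm).resolve_left hz0
  exact hne.elim (· hU) (· hW)

/-! ### The anti-continuum limit -/

/-- Quantitative closeness of a soliton to the one-site profile. -/
structure NearSingleSite (ε : ℝ) (ψ : RealSeq) : Prop where
  sq_site : |ψ 0 ^ 2 - 1| ≤ 4 * ε
  sq_off : ∀ m, m ≠ 0 → ψ m ^ 2 ≤ 4 * ε
  site : |ψ 0 - 1| ≤ 4 * ε
  norm_le : ‖ψ‖ ≤ 2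

/-- Closeness without a rate suffices: the stationary equation equates `ψ_m (ψ_m² - 1)` with `ε`
times a bounded quantity, and one may divide by `ψ_0 ≥ 3/4` at the centre and by `1 - ψ_m² ≥ 15/16`
elsewhere. -/
lemma nearSingleSite_of_norm_sub_le {ε : ℝ} (hε : 0 < ε) {ψ : RealSeq}
    (hst : IsStationary 1 ε ψ) (hpos : ∀ m, 0 < ψ m)
    (h : ‖ψ - lp.single 2 (0 : ℤ) (1 : ℝ)‖ ≤ 1 / 4) : NearSingleSite ε ψ := by
  have hc : ∀ m, |ψ m - lp.single (E := fun _ : ℤ => ℝ) 2 (0 : ℤ) (1 : ℝ) m| ≤ 1 / 4 := fun m => by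
    have := lp.norm_apply_le_norm (p := 2) (by norm_num) (ψ - lp.single 2 (0 : ℤ) (1 : ℝ)) m
    exact this.trans h
  have h0 : |ψ 0 - 1| ≤ 1 / 4 := by simpa using hc 0
  have hm : ∀ m, m ≠ 0 → ψ m ≤ 1 / 4 := fun m hm => by
    have := hc m
    rw [lp.single_apply_ne _ _ _ hm, sub_zero] at this
    exact (le_abs_self _).trans this
  rw [abs_le] at h0
  have hb : ∀ m, ψ m ≤ 5 / 4 := fun m => by
    by_cases h1 : m = 0
    · subst h1; linarith
    · linarith [hm m h1]
  have hsq : |ψ 0 ^ 2 - 1| ≤ 4 * ε := by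
    have h1 := hst 0
    rw [sq_abs] at h1
    have h2 := hm (0 + 1) (by norm_num)
    have h3 := hm (0 - 1) (by norm_num)
    have h4 := hpos (0 + 1)
    have h5 := hpos (0 - 1)
    have h6 : ψ 0 * (ψ 0 ^ 2 - 1) = ε * (2 * ψ 0 - ψ (0 + 1) - ψ (0 - 1)) := by
      linear_combination h1
    have h7 : |ψ 0 * (ψ 0 ^ 2 - 1)| ≤ ε * 3 := by
      rw [h6, abs_mul, abs_of_pos hε]
      gcongr
      rw [abs_le]; constructor <;> linarith [hb 0]
    rw [abs_mul, abs_of_pos (hpos 0)] at h7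
    nlinarith [abs_nonneg (ψ 0 ^ 2 - 1)]
  refine ⟨hsq, fun m h1 => ?_, ?_, ?_⟩
  · have h2 := hst m
    rw [sq_abs] at h2
    have h3 := hm m h1
    have h4 := hpos m
    have h5 : ψ m * (1 - ψ m ^ 2) ≤ ε * (5 / 2) := by
      have : ψ m * (1 - ψ m ^ 2) = ε * (ψ (m + 1) + ψ (m - 1) - 2 * ψ m) := by
        linear_combination -h2
      rw [this]
      gcongr
      linarith [hb (m + 1), hb (m - 1)]
    have h6 : ψ m ^ 2 ≤ 1 / 16 := by nlinarith
    nlinarith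
  · have : |ψ 0 - 1| * (ψ 0 + 1) = |ψ 0 ^ 2 - 1| := by
      rw [show ψ 0 ^ 2 - 1 = (ψ 0 - 1) * (ψ 0 + 1) by ring, abs_mul,
        abs_of_pos (show 0 < ψ 0 + 1 by linarith [hpos 0])]
    nlinarith [abs_nonneg (ψ 0 - 1), hpos 0]
  · have h1 : ‖lp.single (E := fun _ : ℤ => ℝ) 2 (0 : ℤ) (1 : ℝ)‖ = 1 := by
      rw [lp.norm_single (by norm_num)]; simp
    have := norm_le_norm_add_norm_sub' ψ (lp.single (E := fun _ : ℤ => ℝ) 2 (0 : ℤ) (1 : ℝ))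
    linarith

namespace NearSingleSite

variable {ε : ℝ} {ψ : RealSeq}

lemma norm_mulSq_sub_le (h : NearSingleSite ε ψ) (hε : 0 < ε) (x : ComplexSeq) :
    ‖mulSq ψ x - x 0 • StripeLattice.site 0‖ ≤ 4 * ε * ‖x‖ := by
  have h1 : ‖((4 * ε : ℝ) : ℂ) • x‖ = 4 * ε * ‖x‖ := by
    rw [norm_smul, Complex.norm_real, Real.norm_of_nonneg (by positivity)]
  rw [← h1]
  refine lp.norm_mono (by norm_num) fun m => ?_
  rw [lp.coeFn_smul, Pi.smul_apply, norm_smul, Complex.norm_real,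
    Real.norm_of_nonneg (by positivity : (0 : ℝ) ≤ 4 * ε), lp.coeFn_sub, Pi.sub_apply,
    mulSq_apply, lp.coeFn_smul, Pi.smul_apply, smul_eq_mul]
  by_cases hm : m = 0
  · subst hm
    rw [lp.single_apply_self]
    have : (ψ 0 : ℂ) ^ 2 * x 0 - x 0 * 1 = ((ψ 0 ^ 2 - 1 : ℝ) : ℂ) * x 0 := by push_cast; ring
    rw [this, norm_mul, Complex.norm_real, Real.norm_eq_abs]
    gcongr
    exact h.sq_site
  · rw [lp.single_apply_ne _ _ _ hm, mul_zero, sub_zero, norm_mul, ← Complex.ofReal_pow,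
      Complex.norm_real, Real.norm_of_nonneg (sq_nonneg _)]
    gcongr
    exact h.sq_off m hm

lemma norm_opMinus_sub_le (h : NearSingleSite ε ψ) (hε : 0 < ε) (p : ℝ) (x : ComplexSeq) :
    ‖opMinus ε p ψ x - ((1 + p ^ 2 : ℝ) : ℂ) • x + x 0 • StripeLattice.site 0‖ ≤ 8 * ε * ‖x‖ := by
  have e : opMinus ε p ψ x - ((1 + p ^ 2 : ℝ) : ℂ) • x + x 0 • StripeLattice.site 0 =
      (ε : ℂ) • ((2 : ℂ) • x - shift 1 x - shift (-1) x)
        - (mulSq ψ x - x 0 • StripeLattice.site 0) := by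
    simp only [opMinus, freeOp, sub_apply, add_apply, smul_apply, one_apply_eq_self]
    push_cast
    module
  have h1 : ‖(2 : ℂ) • x - shift 1 x - shift (-1) x‖ ≤ 4 * ‖x‖ := by
    have h2 := norm_sub_le ((2 : ℂ) • x - shift 1 x) (shift (-1) x)
    have h3 := norm_sub_le ((2 : ℂ) • x) (shift 1 x)
    have h4 : ‖(2 : ℂ) • x‖ = 2 * ‖x‖ := by rw [norm_smul]; simp
    linarith [norm_shift_le 1 x, norm_shift_le (-1) x]
  rw [e]
  refine (norm_sub_le _ _).trans ?_
  rw [norm_smul, Complex.norm_real, Real.norm_of_nonneg hε.le]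
  have := h.norm_mulSq_sub_le hε x
  nlinarith

lemma norm_opPlus_sub_le (h : NearSingleSite ε ψ) (hε : 0 < ε) (p : ℝ) (x : ComplexSeq) :
    ‖opPlus ε p ψ x - ((1 + p ^ 2 : ℝ) : ℂ) • x + (3 * x 0) • StripeLattice.site 0‖
      ≤ 16 * ε * ‖x‖ := by
  have e : opPlus ε p ψ x - ((1 + p ^ 2 : ℝ) : ℂ) • x + (3 * x 0) • StripeLattice.site 0 =
      (opMinus ε p ψ x - ((1 + p ^ 2 : ℝ) : ℂ) • x + x 0 • StripeLattice.site 0)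
        - (2 : ℂ) • (mulSq ψ x - x 0 • StripeLattice.site 0) := by
    rw [opPlus, sub_apply, smul_apply]
    module
  rw [e]
  refine (norm_sub_le _ _).trans ?_
  rw [norm_smul, Complex.norm_ofNat]
  linarith [h.norm_mulSq_sub_le hε x, h.norm_opMinus_sub_le hε p x]

/-- The limiting form `‖x‖² - 3|x_0|²` has minimum `-2` on the unit sphere, attained at site 0. -/
lemma abs_thresholdSq_sub_two_le (h : NearSingleSite ε ψ) (hε : 0 < ε) :
    |thresholdSq ε ψ - 2| ≤ 16 * ε := by
  have key : ∀ x : ComplexSeq, |(⟪opPlus ε 0 ψ x, x⟫_ℂ).re - (‖x‖ ^ 2 - 3 * ‖x 0‖ ^ 2)|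
      ≤ 16 * ε * ‖x‖ ^ 2 := by
    intro x
    set r := opPlus ε 0 ψ x - ((1 + (0 : ℝ) ^ 2 : ℝ) : ℂ) • x + (3 * x 0) • StripeLattice.site 0
      with hr
    have e : opPlus ε 0 ψ x = r + x - (3 * x 0) • StripeLattice.site 0 := by
      rw [hr]; simp only [zero_pow two_ne_zero, add_zero, Complex.ofReal_one, one_smul]; abel
    have e1 : ⟪opPlus ε 0 ψ x, x⟫_ℂ = ⟪r, x⟫_ℂ + ((‖x‖ ^ 2 - 3 * ‖x 0‖ ^ 2 : ℝ) : ℂ) := by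
      rw [e, inner_sub_left, inner_add_left, inner_smul_left, inner_site_left,
        inner_self_eq_norm_sq_to_K, map_mul, mul_assoc, Complex.conj_mul', map_ofNat]
      push_cast
      simp only [Complex.coe_algebraMap]
      ring
    rw [e1, Complex.add_re, Complex.ofReal_re, add_sub_cancel_right]
    have h1 := Complex.abs_re_le_norm ⟪r, x⟫_ℂ
    have h2 := norm_inner_le_norm (𝕜 := ℂ) r x
    have h3 := mul_le_mul_of_nonneg_right (h.norm_opPlus_sub_le hε 0 x) (norm_nonneg x)
    rw [← hr] at h3
    linarith
  rw [abs_le]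
  constructor
  · have h1 := neg_re_inner_div_le ε ψ (StripeLattice.site 0)
    have h2 := key (StripeLattice.site 0)
    rw [norm_site, lp.single_apply_self, norm_one, abs_le] at h2
    rw [norm_site, one_pow, div_one] at h1
    linarith [h2.2]
  · rw [sub_le_iff_le_add]
    refine ciSup_le fun x => div_le_of_le_mul₀ (sq_nonneg _) (by positivity) ?_
    have h1 := (abs_le.1 (key x)).1
    have h2 : ‖x 0‖ ^ 2 ≤ ‖x‖ ^ 2 := by
      gcongr
      exact lp.norm_apply_le_norm (by norm_num) x 0
    linarith

lemma abs_sq_sub_le (h : NearSingleSite ε ψ) (hε : 0 < ε) (hε' : ε ≤ 1 / 64)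
    (hst : IsStationary 1 ε ψ) {p lam : ℝ} (hp : p ^ 2 ≤ 2) (hlam : 0 < lam)
    (he : IsStabilityEigenvalue 1 1 ε p ψ (lam : ℂ)) :
    |lam ^ 2 - p ^ 2 * (2 - p ^ 2)| ≤ 94 * (p ^ 2 + lam) * (16 * ε) := by
  obtain ⟨U, W, hne, h1, h2⟩ := isStabilityEigenvalue_iff.1 he
  -- Exact solvability condition: `L₋(p)ψ = p²ψ`, so pairing the second equation with `ψ` leaves no
  -- `O(ε)` remainder.
  have hf : (p : ℂ) ^ 2 * ⟪toComplex ψ, W⟫_ℂ = lam * ⟪toComplex ψ, U⟫_ℂ := by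
    have h3 : ⟪opMinus ε p ψ (toComplex ψ), W⟫_ℂ = ⟪toComplex ψ, opMinus ε p ψ W⟫_ℂ :=
      (isSelfAdjoint_opMinus ε p ψ).isSymmetric _ _
    have h4 : opMinus ε p ψ (toComplex ψ) = ((p ^ 2 : ℝ) : ℂ) • toComplex ψ := by
      rw [opMinus_eq_add, add_apply, opMinus_toComplex hst, zero_add,
        Algebra.algebraMap_eq_smul_one]
      ext m; rfl
    rw [h2, h4, inner_smul_left, inner_smul_right, Complex.conj_ofReal] at h3
    push_cast at h3
    exact h3
  refine abs_sq_sub_le_of_perturbation (H := ComplexSeq) (e := StripeLattice.site 0)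
    (f := toComplex ψ) (U := U) (W := W)
    (r := opPlus ε p ψ U - ((1 + p ^ 2 : ℝ) : ℂ) • U + (3 * U 0) • StripeLattice.site 0)
    (s := opMinus ε p ψ W - ((1 + p ^ 2 : ℝ) : ℂ) • W + W 0 • StripeLattice.site 0)
    (norm_site 0) hp hlam (by positivity) (by linarith) hne ?_ ?_
    (h.norm_opPlus_sub_le hε p U) ?_ hf ?_ ?_
  · rw [← h1, inner_site_left]; abel
  · rw [← h2, inner_site_left]; abel
  · refine (h.norm_opMinus_sub_le hε p W).trans ?_
    have := norm_nonneg W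
    gcongr
    norm_num
  · have h3 : ⟪toComplex ψ, StripeLattice.site 0⟫_ℂ = ψ 0 := by
      rw [← inner_conj_symm, inner_site_left, toComplex_apply, Complex.conj_ofReal]
    rw [h3, ← Complex.ofReal_one, ← Complex.ofReal_sub, Complex.norm_real, Real.norm_eq_abs]
    linarith [h.site]
  · rw [norm_toComplex]; exact h.norm_le

end NearSingleSite

lemma IsFundamentalSoliton.exists_nearSingleSite {ψ : ℝ → RealSeq}
    (hψ : IsFundamentalSoliton 1 ψ) :
    ∃ ε₁ : ℝ, 0 < ε₁ ∧ ε₁ ≤ 1 / 64 ∧ ∀ ε, 0 < ε → ε < ε₁ → NearSingleSite ε (ψ ε) := by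
  have h := hψ.singleSite.eventually (Metric.closedBall_mem_nhds _ (by norm_num : (0 : ℝ) < 1 / 4))
  obtain ⟨u, hu, hsub⟩ := mem_nhdsGT_iff_exists_Ioo_subset.1 h
  -- `ε ≤ 1/64` keeps the perturbation size `16 ε` below the required `1/4`.
  refine ⟨min u (1 / 64), lt_min hu (by norm_num), min_le_right _ _, fun ε h0 h1 => ?_⟩
  have h2 := hsub ⟨h0, h1.trans_le (min_le_left _ _)⟩
  rw [Set.mem_ofPred_eq, dist_eq_norm] at h2
  exact nearSingleSite_of_norm_sub_le h0 (hψ.stationary ε h0) (hψ.pos ε h0) h2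

/-! ### Passing to square roots and conclusion -/

/-- The quadratic estimate for the eigenvalue implies a linear one, uniformly for wavenumbers
below `q < √2`. -/
lemma abs_sub_le_of_abs_sq_sub_le {p q lam η : ℝ} (hq2 : q < √2) (hp0 : 0 < |p|)
    (hpq : |p| ≤ q) (hlam : 0 < lam) (hη : 0 ≤ η)
    (h : |lam ^ 2 - p ^ 2 * (2 - p ^ 2)| ≤ (p ^ 2 + lam) * η) :
    |lam - |p| * √(2 - p ^ 2)| ≤ (1 + 2 / √(2 - q ^ 2)) * η := by
  rw [← sq_abs p] at *
  set P := |p|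
  have hq0 : 0 < q := hp0.trans_le hpq
  have hq : q ^ 2 < 2 := by
    have := Real.sq_sqrt (show (0 : ℝ) ≤ 2 by norm_num)
    nlinarith
  have hP : P ^ 2 ≤ q ^ 2 := by gcongr
  set c := √(2 - q ^ 2)
  have hc : 0 < c := Real.sqrt_pos.2 (by linarith)
  have hcs : c ≤ √(2 - P ^ 2) := Real.sqrt_le_sqrt (by linarith)
  set l := P * √(2 - P ^ 2) with hl
  have hl2 : l ^ 2 = P ^ 2 * (2 - P ^ 2) := by
    rw [hl, mul_pow, Real.sq_sqrt (by linarith)]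
  have hlc : P * c ≤ l := by rw [hl]; gcongr
  have hl0 : 0 < l := (mul_pos hp0 hc).trans_le hlc
  have hPl : P ^ 2 ≤ 2 / c * l := by
    rw [div_mul_eq_mul_div, le_div_iff₀ hc]
    have : P ≤ 2 := by nlinarith
    nlinarith [mul_pos hp0 hc]
  -- This lets the factor `lam + l` of `lam² - l²` cancel even as `P → 0`.
  have h3 : P ^ 2 + lam ≤ (1 + 2 / c) * (lam + l) := by
    have : 0 < 2 / c := by positivity
    nlinarith [mul_pos this hlam]
  rw [← hl2] at h
  have h4 : |lam - l| * (lam + l) ≤ (1 + 2 / c) * η * (lam + l) := by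
    have : |lam - l| * (lam + l) = |lam ^ 2 - l ^ 2| := by
      rw [show lam ^ 2 - l ^ 2 = (lam - l) * (lam + l) by ring, abs_mul,
        abs_of_pos (show 0 < lam + l by positivity)]
    rw [this]
    calc _ ≤ (P ^ 2 + lam) * η := h
      _ ≤ (1 + 2 / c) * (lam + l) * η := by gcongr
      _ = _ := by ring
  exact le_of_mul_le_mul_right h4 (by positivity)

lemma abs_sqrt_sub_sqrt_two_le {x η : ℝ} (hx : 0 ≤ x) (h : |x - 2| ≤ η) : |√x - √2| ≤ η := by
  have h1 : (√x - √2) * (√x + √2) = x - 2 := by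
    have := Real.sq_sqrt hx
    have := Real.sq_sqrt (show (0 : ℝ) ≤ 2 by norm_num)
    nlinarith
  have h2 : 1 ≤ √x + √2 := by
    have := Real.one_le_sqrt.2 (show (1 : ℝ) ≤ 2 by norm_num)
    linarith [Real.sqrt_nonneg x]
  rw [← h1, abs_mul, abs_of_pos (by linarith : 0 < √x + √2)] at h
  nlinarith [abs_nonneg (√x - √2)]

end StripeLattice

open StripeLattice in
theorem theorem3 (ψ : ℝ → StripeLattice.RealSeq)
    (hψ : StripeLattice.IsFundamentalSoliton 1 ψ) :
    ∃ (p₀ : ℝ → ℝ) (lam : ℝ → ℝ → ℝ),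
      (∀ ε : ℝ, 0 < ε →
        0 < p₀ ε ∧
        (∀ p : ℝ, 0 < |p| → |p| < p₀ ε →
          0 < lam ε p ∧
          StripeLattice.IsStabilityEigenvalue 1 1 ε p (ψ ε) (lam ε p : ℂ) ∧
          StripeLattice.IsStabilityEigenvalue 1 1 ε p (ψ ε) (-(lam ε p : ℂ))) ∧
        (∀ p : ℝ, p₀ ε ≤ |p| → ∀ z : ℂ, 0 < z.re →
          ¬ StripeLattice.IsStabilityEigenvalue 1 1 ε p (ψ ε) z) ∧
        StripeLattice.IsTransverselyUnstable 1 1 ε (ψ ε)) ∧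
      (fun ε : ℝ => p₀ ε - √2) =O[𝓝[>] 0] (fun ε : ℝ => ε) ∧
      (∀ q : ℝ, 0 < q → q < √2 →
        ∃ C ε₁ : ℝ, 0 < C ∧ 0 < ε₁ ∧
          ∀ ε : ℝ, 0 < ε → ε < ε₁ → ∀ p : ℝ, 0 < |p| → |p| ≤ q →
            |p| < p₀ ε ∧ |lam ε p - |p| * √(2 - p ^ 2)| ≤ C * ε) := by
  have hex : ∀ ε p : ℝ, ∃ l : ℝ, 0 < ε → 0 < |p| → |p| < √(thresholdSq ε (ψ ε)) →
      0 < l ∧ IsStabilityEigenvalue 1 1 ε p (ψ ε) (l : ℂ) := by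
    intro ε p
    by_cases h : 0 < ε ∧ 0 < |p| ∧ |p| < √(thresholdSq ε (ψ ε))
    · obtain ⟨hε, hp, hpt⟩ := h
      rw [Real.lt_sqrt hp.le, sq_abs] at hpt
      obtain ⟨l, hl⟩ := exists_pos_eigenvalue hε (hψ.stationary ε hε) (hψ.pos ε hε)
        (by rw [← sq_abs]; positivity) hpt
      exact ⟨l, fun _ _ _ => hl⟩
    -- The value 0 outside the unstable range is arbitrary.
    · exact ⟨0, fun h1 h2 h3 => (h ⟨h1, h2, h3⟩).elim⟩
  choose lam hlam using hex
  obtain ⟨ε₁, hε₁, hε₁', hnear⟩ := hψ.exists_nearSingleSite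
  have hp₀ : ∀ ε, 0 < ε → ε < ε₁ → |√(thresholdSq ε (ψ ε)) - √2| ≤ 16 * ε := fun ε h0 h1 =>
    abs_sqrt_sub_sqrt_two_le (thresholdSq_pos (hψ.stationary ε h0) (hψ.pos ε h0)).le
      ((hnear ε h0 h1).abs_thresholdSq_sub_two_le h0)
  refine ⟨fun ε => √(thresholdSq ε (ψ ε)), lam, fun ε hε => ?_, ?_, fun q hq hq2 => ?_⟩
  · have hst := hψ.stationary ε hε
    have hpos := hψ.pos ε hε
    have ht := Real.sqrt_pos.2 (thresholdSq_pos hst hpos)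
    refine ⟨ht, fun p hp hpt => ?_, fun p hp z hz => ?_, ?_⟩
    · obtain ⟨h1, h2⟩ := hlam ε p hε hp hpt
      exact ⟨h1, h2, h2.neg⟩
    · have h1 : 0 < |p| := ht.trans_le hp
      rw [Real.sqrt_le_left h1.le, sq_abs] at hp
      exact not_isStabilityEigenvalue_of_re_pos hε hst hpos (by rw [← sq_abs]; positivity) hp hz
    · set t := √(thresholdSq ε (ψ ε))
      have h2 : 0 < |t / 2| := abs_pos.2 (by positivity)
      obtain ⟨h3, h4⟩ := hlam ε (t / 2) hε h2 (by rw [abs_of_pos (by positivity)]; linarith)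
      exact ⟨t / 2, by positivity, lam ε (t / 2), by simpa using h3, h4⟩
  · refine IsBigO.of_bound 16 ?_
    filter_upwards [Ioo_mem_nhdsGT hε₁] with ε hε
    rw [Real.norm_eq_abs, Real.norm_of_nonneg hε.1.le]
    exact hp₀ ε hε.1 hε.2
  · have hc : 0 < 1 + 2 / √(2 - q ^ 2) := by positivity
    -- `1504 = 94 · 16`; the bound `(√2 - q)/16` ensures `q < √2 - 16 ε ≤ p₀ ε`.
    refine ⟨(1 + 2 / √(2 - q ^ 2)) * 1504, min ε₁ ((√2 - q) / 16), by positivity,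
      lt_min hε₁ (by linarith), fun ε h0 h1 p hp hpq => ?_⟩
    have h2 : ε < ε₁ := h1.trans_le (min_le_left _ _)
    have h3 : ε < (√2 - q) / 16 := h1.trans_le (min_le_right _ _)
    have hpt : |p| < √(thresholdSq ε (ψ ε)) := by
      have := (abs_le.1 (hp₀ ε h0 h2)).1
      linarith
    refine ⟨hpt, ?_⟩
    obtain ⟨h4, h5⟩ := hlam ε p h0 hp hpt
    have hp2 : p ^ 2 ≤ 2 := by
      rw [← sq_abs, ← Real.le_sqrt (abs_nonneg p) (by norm_num)]
      linarith
    have h6 := (hnear ε h0 h2).abs_sq_sub_le h0 (by linarith) (hψ.stationary ε h0) hp2 h4 h5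
    rw [mul_assoc]
    exact abs_sub_le_of_abs_sq_sub_le hq2 hp hpq h4 (by positivity) (by linarith)
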